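/- **Theorem 5.2 (privacy of DP-PMTLR).** Let $d,n,m,T\ge 1$ be integers, $\mu>0$, $0<\eta<1$ and $\lambda\in\mathbb R$. Let $B_1,\dots,B_m\in\mathbb R^d$ be a public dataset whose second-moment matrix $\hat\Sigma_B=\frac1m\sum_{i=1}^m B_iB_i^{T}$ is positive definite. For a private dataset $D=(A_i,y_i)_{i=1}^n$ with $A_i\in\mathbb R^d$ and $y_i\in\{0,1\}$, the algorithm DP-PMTLR does the following. 1. *Transform and truncate.* Let $R=\sqrt{d(1+\log(2n/\eta))}$ and $Z_i=\hat\Sigma_B^{-1/2}A_i$; put $\tilde A_i=R\,Z_i/\|Z_i\|_2$ if $\|Z_i\|_2\ge R$ and $\tilde A_i=Z_i$ otherwise. 2. *Noise levels.* $\displaystyle\sigma_1=\frac{\sqrt T\,d\,(1+\log(2n/\eta))}{2\mu n},\qquad \sigma_2=\frac{2\sqrt{T\,d\,(1+\log(2n/\eta))}}{\mu n}.$ 3. *Noisy Newton method.* Let $$\tilde{\mathcal L}(\beta)=-\frac1n\sum_{i=1}^n\bigl[y_i\tilde A_i^{T}\beta-\log(1+e^{\tilde A_i^{T}\beta})\bigr]+\frac\lambda2\bigl\|\hat\Sigma_B^{-1/2}\beta\bigr\|_2^2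 .$$ Start from $\beta^{(0)}=0$ and for $t=0,\dots,T-1$ set $$\beta^{(t+1)}=\beta^{(t)}-\bigl(\nabla^2\tilde{\mathcal L}(\beta^{(t)})+\mathbf G_t\bigr)^{-1}\bigl(\nabla\tilde{\mathcal L}(\beta^{(t)})+\mathbf g_t\bigr),$$ where all the noise is independent, $\mathbf G_t$ is a symmetric $d\times d$ random matrix whose entries on and above the diagonal are i.i.d. $\mathcal N(0,\sigma_1^2)$, and $\mathbf g_t\sim\mathcal N(0,\sigma_2^2\mathbf I_d)$. 4. *Output* $\bar\beta^{DP}=\hat\Sigma_B^{-1/2}\beta^{(T)}$. Then DP-PMTLR, as a randomized algorithm of the private dataset, satisfies $\sqrt2\,\mu$-Gaussian differential privacy: for any two private datasets $D,D'$ of size $n$ that differ in at most one sample and any $\alpha\in[0,1]$, every (randomized) test of level $\alpha$, based on the output, of $H_0$: "the dataset is $D$" against $H_1$: "the dataset is $D'$" has power at most $1-\Phi\bigl(\Phi^{-1}(1-\alpha)-\sqrt2\,\mu\bigr)$, where $\Phi$ is the standard normal distribution function, $\Phi^{-1}(1)=+\infty$ and $\Phi^{-1}(0)=-\infty$. -/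

import Mathlib

open MeasureTheory ProbabilityTheory Matrix

noncomputable section

namespace PMT

/-! ### Gaussian differential privacy -/

/-- The quantile function `Φ⁻¹` of the standard normal distribution (meaningful on `(0, 1)`). -/
def normalQuantile (p : ℝ) : ℝ := sInf {x : ℝ | p ≤ cdf (gaussianReal 0 1) x}

/-- The Gaussian trade-off function `G_μ(α) = Φ(Φ⁻¹(1 - α) - μ)` on `[0, 1]`, with the usual
conventions `Φ⁻¹(1) = +∞`, `Φ⁻¹(0) = -∞` at the end points. -/
def gaussianTradeoff (μ α : ℝ) : ℝ :=
  if α ≤ 0 then 1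
  else if 1 ≤ α then 0
  else cdf (gaussianReal 0 1) (normalQuantile (1 - α) - μ)

/-- Two datasets of size `n` are neighbouring if they agree except possibly at one sample. -/
def Neighbor {𝒳 : Type*} {n : ℕ} (D D' : Fin n → 𝒳) : Prop :=
  ∃ i, ∀ j, j ≠ i → D j = D' j

/-- `f`-differential privacy of a randomized algorithm, given by the law of its output on every
dataset. A test of `H₀ : D` against `H₁ : D'` is a measurable `φ : 𝒮 → [0, 1]`, where `φ s` is
the probability of rejecting `H₀` on seeing the output `s`; its level is the expectation of `φ`
under `H₀`, its power the expectation of `φ` under `H₁`. Every test of level `α` must have power at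
most `1 - f α`. -/
def IsFDP {𝒳 𝒮 : Type*} [MeasurableSpace 𝒮] {n : ℕ} (f : ℝ → ℝ)
    (M : (Fin n → 𝒳) → ProbabilityMeasure 𝒮) : Prop :=
  ∀ D D' : Fin n → 𝒳, Neighbor D D' →
    ∀ α ∈ Set.Icc (0 : ℝ) 1, ∀ φ : 𝒮 → ℝ, Measurable φ → (∀ s, φ s ∈ Set.Icc (0 : ℝ) 1) →
      ∫ s, φ s ∂(M D : Measure 𝒮) ≤ α → ∫ s, φ s ∂(M D' : Measure 𝒮) ≤ 1 - f α

/-- `μ`-Gaussian differential privacy. -/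
def IsGDP {𝒳 𝒮 : Type*} [MeasurableSpace 𝒮] {n : ℕ} (μ : ℝ)
    (M : (Fin n → 𝒳) → ProbabilityMeasure 𝒮) : Prop :=
  IsFDP (gaussianTradeoff μ) M

/-! ### Public-moment-guided truncation -/

/-- The second-moment matrix `(1 / m) ∑ᵢ Bᵢ Bᵢᵀ`. -/
def secondMoment {d m : ℕ} (B : Fin m → Fin d → ℝ) : Matrix (Fin d) (Fin d) ℝ :=
  (m : ℝ)⁻¹ • ∑ i, vecMulVec (B i) (B i)

section
open scoped MatrixOrder Matrix.Norms.L2Operator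

/-- `S^(-1/2)` for a positive definite matrix `S`: the inverse of its positive square root. -/
def invSqrt {d : ℕ} (S : Matrix (Fin d) (Fin d) ℝ) : Matrix (Fin d) (Fin d) ℝ :=
  (CFC.sqrt S)⁻¹

theorem invSqrt_posDef {d : ℕ} {S : Matrix (Fin d) (Fin d) ℝ} (hS : S.PosDef) :
    (invSqrt S).PosDef := by
  have h0 : (CFC.sqrt S).PosSemidef := (CFC.sqrt_nonneg S).posSemidef
  have hsq : CFC.sqrt S * CFC.sqrt S = S := CFC.sqrt_mul_sqrt_self S hS.posSemidef.nonneg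
  have hdet : (CFC.sqrt S).det ≠ 0 := by
    intro h
    have := hS.det_pos.ne'
    rw [← hsq, det_mul, h] at this
    simp at this
  exact ((h0.posDef_iff_det_ne_zero).2 hdet).inv

theorem invSqrt_mul_self {d : ℕ} {S : Matrix (Fin d) (Fin d) ℝ} (hS : S.PosDef) :
    invSqrt S * invSqrt S = S⁻¹ := by
  rw [invSqrt, ← Matrix.mul_inv_rev, CFC.sqrt_mul_sqrt_self S hS.posSemidef.nonneg]

end

/-- The Euclidean norm of a vector. -/
def l2norm {d : ℕ} (v : Fin d → ℝ) : ℝ := ‖WithLp.toLp 2 v‖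

/-- The truncation radius `√(d (1 + log (2 n / η)))`. -/
def radius (d n : ℕ) (η : ℝ) : ℝ := √(d * (1 + Real.log (2 * n / η)))

/-- Truncation of a vector to the ball of radius `R`. -/
def truncate {d : ℕ} (R : ℝ) (v : Fin d → ℝ) : Fin d → ℝ :=
  if R ≤ l2norm v then (R / l2norm v) • v else v

/-- The private covariates `Aᵢ` are transformed to `Σ_B^(-1/2) Aᵢ` and then truncated. -/
def transform {d n m : ℕ} (η : ℝ) (B : Fin m → Fin d → ℝ) (A : Fin n → Fin d → ℝ) :
    Fin n → Fin d → ℝ :=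
  fun i => truncate (radius d n η) (invSqrt (secondMoment B) *ᵥ A i)

/-! ### The logistic loss on transformed data -/

/-- The loss `-(1/n) ∑ᵢ (yᵢ Xᵢᵀβ - log (1 + exp (Xᵢᵀβ))) + (lam/2) ‖S^(-1/2) β‖²`. -/
def loss {d n : ℕ} (lam : ℝ) (S : Matrix (Fin d) (Fin d) ℝ) (X : Fin n → Fin d → ℝ)
    (y : Fin n → Fin 2) (β : Fin d → ℝ) : ℝ :=
  -((n : ℝ)⁻¹ * ∑ i, (((y i : ℕ) : ℝ) * (X i ⬝ᵥ β) - Real.log (1 + Real.exp (X i ⬝ᵥ β))))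
    + lam / 2 * l2norm (invSqrt S *ᵥ β) ^ 2

/-- The gradient `-(1/n) Xᵀ (y - p) + lam S⁻¹ β`, where `pᵢ = 1 / (1 + exp (-Xᵢᵀβ))`. -/
def gradLoss {d n : ℕ} (lam : ℝ) (S : Matrix (Fin d) (Fin d) ℝ) (X : Fin n → Fin d → ℝ)
    (y : Fin n → Fin 2) (β : Fin d → ℝ) : Fin d → ℝ :=
  -((n : ℝ)⁻¹ • ∑ i, (((y i : ℕ) : ℝ) - Real.sigmoid (X i ⬝ᵥ β)) • X i) + lam • (S⁻¹ *ᵥ β)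

/-- The Hessian `(1/n) ∑ᵢ pᵢ (1 - pᵢ) Xᵢ Xᵢᵀ + lam S⁻¹`. -/
def hessLoss {d n : ℕ} (lam : ℝ) (S : Matrix (Fin d) (Fin d) ℝ) (X : Fin n → Fin d → ℝ)
    (β : Fin d → ℝ) : Matrix (Fin d) (Fin d) ℝ :=
  (n : ℝ)⁻¹ • ∑ i, (Real.sigmoid (X i ⬝ᵥ β) * (1 - Real.sigmoid (X i ⬝ᵥ β))) •
    vecMulVec (X i) (X i) + lam • S⁻¹

theorem l2norm_sq {d : ℕ} (v : Fin d → ℝ) : l2norm v ^ 2 = v ⬝ᵥ v := by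
  rw [l2norm, EuclideanSpace.norm_sq_eq]
  simp [dotProduct, sq]

theorem l2norm_invSqrt_sq {d : ℕ} {S : Matrix (Fin d) (Fin d) ℝ} (hS : S.PosDef)
    (v : Fin d → ℝ) : l2norm (invSqrt S *ᵥ v) ^ 2 = v ⬝ᵥ (S⁻¹ *ᵥ v) := by
  have hT : (invSqrt S)ᵀ = invSqrt S := by
    have := (invSqrt_posDef hS).isHermitian
    simpa [IsHermitian, conjTranspose_eq_transpose_of_trivial] using this
  rw [l2norm_sq, ← invSqrt_mul_self hS, ← mulVec_mulVec]
  conv_rhs => rw [dotProduct_mulVec, ← mulVec_transpose, hT]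

/-- `gradLoss` is the gradient of `loss`: it gives all its directional derivatives. -/
theorem hasDerivAt_loss {d n : ℕ} (lam : ℝ) {S : Matrix (Fin d) (Fin d) ℝ} (hS : S.PosDef)
    (X : Fin n → Fin d → ℝ) (y : Fin n → Fin 2) (β v : Fin d → ℝ) :
    HasDerivAt (fun t : ℝ => loss lam S X y (β + t • v)) (gradLoss lam S X y β ⬝ᵥ v) 0 := by
  have hSym : ∀ a b : Fin d → ℝ, a ⬝ᵥ (S⁻¹ *ᵥ b) = b ⬝ᵥ (S⁻¹ *ᵥ a) := by
    intro a b
    have hT : (S⁻¹)ᵀ = S⁻¹ := by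
      have := hS.inv.isHermitian
      simpa [IsHermitian, conjTranspose_eq_transpose_of_trivial] using this
    conv_lhs => rw [dotProduct_mulVec, ← mulVec_transpose, hT, dotProduct_comm]
  have hs : ∀ i, HasDerivAt (fun t : ℝ => X i ⬝ᵥ (β + t • v)) (X i ⬝ᵥ v) 0 := by
    intro i
    simp only [dotProduct_add, dotProduct_smul, smul_eq_mul]
    simpa using ((hasDerivAt_id (0 : ℝ)).mul_const (X i ⬝ᵥ v)).const_add (X i ⬝ᵥ β)
  have hl : ∀ i, HasDerivAt (fun t : ℝ => ((y i : ℕ) : ℝ) * (X i ⬝ᵥ (β + t • v)) -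
      Real.log (1 + Real.exp (X i ⬝ᵥ (β + t • v))))
      ((((y i : ℕ) : ℝ) - Real.sigmoid (X i ⬝ᵥ β)) * (X i ⬝ᵥ v)) 0 := by
    intro i
    have h1 := ((hs i).exp.const_add 1).log (by positivity)
    have h2 := ((hs i).const_mul ((y i : ℕ) : ℝ)).sub h1
    refine h2.congr_deriv ?_
    simp only [zero_smul, add_zero, Real.sigmoid_def, Real.exp_neg]
    have := Real.exp_pos (X i ⬝ᵥ β)
    field_simp
    ring
  have hq : HasDerivAt (fun t : ℝ => l2norm (invSqrt S *ᵥ (β + t • v)) ^ 2)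
      (2 * (S⁻¹ *ᵥ β ⬝ᵥ v)) 0 := by
    have he : (fun t : ℝ => l2norm (invSqrt S *ᵥ (β + t • v)) ^ 2) = fun t : ℝ =>
        β ⬝ᵥ (S⁻¹ *ᵥ β) + t * (2 * (S⁻¹ *ᵥ β ⬝ᵥ v)) + t ^ 2 * (v ⬝ᵥ (S⁻¹ *ᵥ v)) := by
      funext t
      rw [l2norm_invSqrt_sq hS]
      simp only [mulVec_add, mulVec_smul, dotProduct_add, add_dotProduct, dotProduct_smul,
        smul_dotProduct, smul_eq_mul]
      rw [hSym β v, dotProduct_comm (S⁻¹ *ᵥ β) v]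
      ring
    rw [he]
    have h1 := ((hasDerivAt_id (0 : ℝ)).mul_const (2 * (S⁻¹ *ᵥ β ⬝ᵥ v))).const_add
      (β ⬝ᵥ (S⁻¹ *ᵥ β))
    have h2 := h1.add ((hasDerivAt_pow 2 (0 : ℝ)).mul_const (v ⬝ᵥ (S⁻¹ *ᵥ v)))
    refine h2.congr_deriv ?_
    simp
  have hsum := HasDerivAt.fun_sum (u := Finset.univ) fun i _ => hl i
  refine ((hsum.const_mul ((n : ℝ)⁻¹)).neg.add (hq.const_mul (lam / 2))).congr_deriv ?_
  simp only [gradLoss, add_dotProduct, neg_dotProduct, smul_dotProduct, sum_dotProduct,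
    smul_eq_mul]
  ring

/-- `hessLoss` is the Hessian of `loss`: it gives all directional derivatives of `gradLoss`. -/
theorem hasDerivAt_gradLoss {d n : ℕ} (lam : ℝ) (S : Matrix (Fin d) (Fin d) ℝ)
    (X : Fin n → Fin d → ℝ) (y : Fin n → Fin 2) (β v : Fin d → ℝ) :
    HasDerivAt (fun t : ℝ => gradLoss lam S X y (β + t • v)) (hessLoss lam S X β *ᵥ v) 0 := by
  have hs : ∀ i, HasDerivAt (fun t : ℝ => X i ⬝ᵥ (β + t • v)) (X i ⬝ᵥ v) 0 := by
    intro i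
    simp only [dotProduct_add, dotProduct_smul, smul_eq_mul]
    simpa using ((hasDerivAt_id (0 : ℝ)).mul_const (X i ⬝ᵥ v)).const_add (X i ⬝ᵥ β)
  have hp : ∀ i, HasDerivAt (fun t : ℝ => (((y i : ℕ) : ℝ) -
      Real.sigmoid (X i ⬝ᵥ (β + t • v))) • X i)
      (-(Real.sigmoid (X i ⬝ᵥ β) * (1 - Real.sigmoid (X i ⬝ᵥ β)) * (X i ⬝ᵥ v)) • X i) 0 := by
    intro i
    have h0 := Real.hasDerivAt_sigmoid (X i ⬝ᵥ (β + (0 : ℝ) • v))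
    have h1 := (h0.comp (0 : ℝ) (hs i)).const_sub ((y i : ℕ) : ℝ)
    simpa using h1.smul_const (X i)
  have hlin : HasDerivAt (fun t : ℝ => lam • (S⁻¹ *ᵥ (β + t • v))) (lam • (S⁻¹ *ᵥ v)) 0 := by
    simp only [mulVec_add, mulVec_smul]
    have h := (((hasDerivAt_id (0 : ℝ)).smul_const (S⁻¹ *ᵥ v)).const_add
      (S⁻¹ *ᵥ β)).fun_const_smul lam
    simpa only [id, one_smul] using h
  have hsum := HasDerivAt.fun_sum (u := Finset.univ) fun i _ => hp i
  refine ((hsum.const_smul ((n : ℝ)⁻¹)).neg.add hlin).congr_deriv ?_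
  simp only [hessLoss, add_mulVec, smul_mulVec, sum_mulVec, vecMulVec_mulVec,
    neg_smul, Finset.sum_neg_distrib, smul_neg, neg_neg]
  congr 2
  refine Finset.sum_congr rfl fun i _ => ?_
  ext j
  simp
  ring

/-! ### The noise -/

/-- The symmetric matrix with entry `z s(i, j)` at `(i, j)`. -/
def symMatrix {d : ℕ} (z : Sym2 (Fin d) → ℝ) : Matrix (Fin d) (Fin d) ℝ :=
  Matrix.of fun i j => z s(i, j)

/-- The centred normal law on `ℝ` with standard deviation `|σ|`. -/
def normal (σ : ℝ) : Measure ℝ := gaussianReal 0 (σ ^ 2).toNNReal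

instance (σ : ℝ) : IsProbabilityMeasure (normal σ) := by
  unfold normal; infer_instance

/-- The joint law of the noise `(G, g)` of one iteration: `symMatrix G` is a symmetric Gaussian
matrix whose entries on and above the diagonal are independent with law `N(0, σ₁²)`, and,
independently, `g` is a vector with law `N(0, σ₂² I)`. -/
def noise (d : ℕ) (σ₁ σ₂ : ℝ) : ProbabilityMeasure ((Sym2 (Fin d) → ℝ) × (Fin d → ℝ)) :=
  ⟨(Measure.pi fun _ : Sym2 (Fin d) => normal σ₁).prod (Measure.pi fun _ : Fin d => normal σ₂),
    inferInstance⟩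

/-- `σ₁ = √T d (1 + log (2 n / η)) / (2 μ n)`. -/
def sigma₁ (d n T : ℕ) (μ η : ℝ) : ℝ :=
  √T * d * (1 + Real.log (2 * n / η)) / (2 * μ * n)

/-- `σ₂ = 2 √(T d (1 + log (2 n / η))) / (μ n)`. -/
def sigma₂ (d n T : ℕ) (μ η : ℝ) : ℝ :=
  2 * √(T * d * (1 + Real.log (2 * n / η))) / (μ * n)

/-! ### The noisy Newton method -/

/-- One noisy Newton update
`β - (∇²L(β) + G)⁻¹ (∇L(β) + g)`, where `p = (β, (G, g))`. -/
def newtonStep {d n : ℕ} (lam : ℝ) (S : Matrix (Fin d) (Fin d) ℝ) (X : Fin n → Fin d → ℝ)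
    (y : Fin n → Fin 2) (p : (Fin d → ℝ) × ((Sym2 (Fin d) → ℝ) × (Fin d → ℝ))) : Fin d → ℝ :=
  p.1 - (hessLoss lam S X p.1 + symMatrix p.2.1)⁻¹ *ᵥ (gradLoss lam S X y p.1 + p.2.2)

theorem measurable_inv_entry {Ω : Type*} [MeasurableSpace Ω] {d : ℕ}
    {F : Ω → Matrix (Fin d) (Fin d) ℝ} (hF : ∀ i j, Measurable fun w => F w i j) (i j : Fin d) :
    Measurable fun w => (F w)⁻¹ i j := by
  have hdet : ∀ H : Ω → Matrix (Fin d) (Fin d) ℝ, (∀ i j, Measurable fun w => H w i j) →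
      Measurable fun w => (H w).det := by
    intro H hH
    simp only [det_apply']
    exact Finset.measurable_fun_sum _ fun s _ =>
      (Finset.measurable_fun_prod _ fun k _ => hH _ _).const_mul _
  simp only [inv_def, Matrix.smul_apply, smul_eq_mul, Ring.inverse_eq_inv', adjugate_apply]
  refine (hdet F hF).inv.mul (hdet _ fun k l => ?_)
  by_cases hk : k = j
  · subst hk
    simp
  · simpa [updateRow_ne hk] using hF k l

theorem measurable_newtonStep {d n : ℕ} (lam : ℝ) (S : Matrix (Fin d) (Fin d) ℝ)
    (X : Fin n → Fin d → ℝ) (y : Fin n → Fin 2) : Measurable (newtonStep lam S X y) := by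
  have hdot : ∀ i, Measurable fun β : Fin d → ℝ => X i ⬝ᵥ β := fun i => by
    unfold dotProduct; fun_prop
  have hsig : ∀ i, Measurable fun β : Fin d → ℝ => Real.sigmoid (X i ⬝ᵥ β) := fun i =>
    continuous_sigmoid.measurable.comp (hdot i)
  have hg : ∀ k, Measurable fun β : Fin d → ℝ => gradLoss lam S X y β k := fun k => by
    simp only [gradLoss, Pi.add_apply, Pi.neg_apply, Pi.smul_apply, Finset.sum_apply,
      smul_eq_mul, mulVec, dotProduct]
    refine Measurable.add ?_ (by fun_prop)
    refine ((Finset.measurable_fun_sum _ fun i _ => ?_).const_mul _).neg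
    exact (measurable_const.sub (hsig i)).mul_const _
  have hH : ∀ k l, Measurable fun β : Fin d → ℝ => hessLoss lam S X β k l := fun k l => by
    simp only [hessLoss, Matrix.add_apply, Matrix.smul_apply, Matrix.sum_apply, smul_eq_mul]
    refine Measurable.add_const ((Finset.measurable_fun_sum _ fun i _ => ?_).const_mul _) _
    exact ((hsig i).mul (measurable_const.sub (hsig i))).mul_const _
  refine measurable_pi_iff.2 fun k => ?_
  simp only [newtonStep, Pi.sub_apply, mulVec, dotProduct, Pi.add_apply]
  refine Measurable.sub (by fun_prop) (Finset.measurable_fun_sum _ fun l _ => ?_)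
  refine (measurable_inv_entry (fun i j => ?_) k l).mul (((hg l).comp measurable_fst).add
    (by fun_prop))
  simp only [Matrix.add_apply, symMatrix, Matrix.of_apply]
  exact ((hH i j).comp measurable_fst).add (by fun_prop)

/-- The law of the iterate `β⁽ᵗ⁾`: `β⁽⁰⁾ = 0`, and `β⁽ᵗ⁺¹⁾` is the noisy Newton update of `β⁽ᵗ⁾`
with a fresh noise that is independent of `β⁽ᵗ⁾`. -/
def iterateLaw {d n : ℕ} (lam : ℝ) (S : Matrix (Fin d) (Fin d) ℝ) (X : Fin n → Fin d → ℝ)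
    (y : Fin n → Fin 2) (σ₁ σ₂ : ℝ) : ℕ → ProbabilityMeasure (Fin d → ℝ)
  | 0 => ⟨Measure.dirac 0, inferInstance⟩
  | t + 1 => ((iterateLaw lam S X y σ₁ σ₂ t).prod (noise d σ₁ σ₂)).map
      (measurable_newtonStep lam S X y).aemeasurable

theorem measurable_mulVec {d : ℕ} (Q : Matrix (Fin d) (Fin d) ℝ) :
    Measurable fun v : Fin d → ℝ => Q *ᵥ v := by
  refine measurable_pi_iff.2 fun k => ?_
  simp only [mulVec, dotProduct]
  fun_prop

/-- Differentially private PMT logistic regression: the law of the output `Σ_B^(-1/2) β⁽ᵀ⁾` on the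
private dataset `D = (Aᵢ, yᵢ)ᵢ`, where `B` is the public dataset. -/
def dpPMTLR {d n m : ℕ} (μ lam η : ℝ) (T : ℕ) (B : Fin m → Fin d → ℝ)
    (D : Fin n → (Fin d → ℝ) × Fin 2) : ProbabilityMeasure (Fin d → ℝ) :=
  (iterateLaw lam (secondMoment B) (transform η B fun i => (D i).1) (fun i => (D i).2)
      (sigma₁ d n T μ η) (sigma₂ d n T μ η) T).map
    (measurable_mulVec (invSqrt (secondMoment B))).aemeasurable

end PMT

end

/-! Changing one sample only shifts the noise. At a fixed iterate the data enter a Newton step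
through the Hessian and the gradient, and Gaussian noise is added to both. The step for `D'` is
therefore the step for `D` with its noise translated by the change of Hessian and gradient
(`exists_newtonStep_eq_add`). Truncation to radius `R` bounds this translation
(`gradLoss_sensitivity`, `hessLoss_sensitivity`).

By Neyman–Pearson, telling a Gaussian vector from a translate by at most `r` standard deviations is
no easier than telling `N(0, 1)` from `N(r, 1)` (`testBound_stdNormalPi`). A step is a function of
the noise, so it inherits this bound.

The steps are adaptive: the translation depends on the current iterate, whose law also differs
between the datasets. `TestBound.integral_le` composes such bounds, and the squares of the
parameters add: both stages are replaced by normal observations, which leaves a shift in the plane.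
Each step spends `μ² / T` on the matrix and `μ² / T` on the vector, so `T` steps spend `2 μ²`. The
final multiplication by a public matrix is post-processing. -/

noncomputable section

namespace PMT

/-! ### The standard normal distribution function -/

/-- The standard normal law. -/
abbrev stdNormal : Measure ℝ := gaussianReal 0 1

/-- The standard normal distribution function. -/
abbrev Phi : ℝ → ℝ := cdf stdNormal

theorem Phi_strictMono : StrictMono Phi := by
  intro a b hab
  have hpos : 0 < stdNormal (Set.Ioc a b) := by
    have h := gaussianReal_absolutelyContinuous' 0 (one_ne_zero (α := NNReal))
    refine pos_iff_ne_zero.2 fun h0 => ?_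
    have := h h0
    simp only [Real.volume_Ioc, ENNReal.ofReal_eq_zero] at this
    linarith
  rw [← measure_cdf stdNormal, StieltjesFunction.measure_Ioc, ENNReal.ofReal_pos] at hpos
  linarith

theorem continuous_Phi : Continuous Phi := by
  have : NullSingletonClass stdNormal := nullSingletonClass_gaussianReal one_ne_zero
  rw [continuous_iff_continuousAt]
  intro x
  have h0 : stdNormal {x} = 0 := measure_singleton x
  rw [← measure_cdf stdNormal, StieltjesFunction.measure_singleton, ENNReal.ofReal_eq_zero,
    sub_nonpos] at h0
  rw [continuousAt_iff_continuous_left_right]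
  refine ⟨?_, (cdf stdNormal).right_continuous x⟩
  rw [continuousWithinAt_Iio_iff_Iic.symm,
    (cdf stdNormal).mono.continuousWithinAt_Iio_iff_leftLim_eq]
  exact le_antisymm ((cdf stdNormal).mono.leftLim_le le_rfl) h0

theorem measurable_Phi : Measurable Phi := continuous_Phi.measurable

theorem Phi_pos (x : ℝ) : 0 < Phi x :=
  (cdf_nonneg stdNormal (x - 1)).trans_lt (Phi_strictMono (by linarith))

theorem Phi_lt_one (x : ℝ) : Phi x < 1 :=
  (Phi_strictMono (show x < x + 1 by linarith)).trans_le (cdf_le_one stdNormal _)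

theorem exists_Phi_eq {p : ℝ} (h0 : 0 < p) (h1 : p < 1) : ∃ q, Phi q = p := by
  obtain ⟨a, ha⟩ := ((tendsto_cdf_atBot stdNormal).eventually (gt_mem_nhds h0)).exists
  obtain ⟨b, hb⟩ := ((tendsto_cdf_atTop stdNormal).eventually (lt_mem_nhds h1)).exists
  exact mem_range_of_exists_le_of_exists_ge continuous_Phi ⟨a, ha.le⟩ ⟨b, hb.le⟩

theorem normalQuantile_Phi (q : ℝ) : normalQuantile (Phi q) = q := by
  have : {x : ℝ | Phi q ≤ cdf (gaussianReal 0 1) x} = Set.Ici q := by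
    ext x
    exact Phi_strictMono.le_iff_le
  rw [normalQuantile, this, csInf_Ici]

theorem stdNormal_real_Ioi (c : ℝ) : stdNormal.real (Set.Ioi c) = 1 - Phi c := by
  rw [← Set.compl_Iic, probReal_compl_eq_one_sub measurableSet_Iic, Phi, cdf_eq_real]

/-! ### The power of the optimal test between two normal laws -/

/-- The power of the optimal test of level `a` of `N(0, 1)` against `N(r, 1)`. -/
def normalPower (r a : ℝ) : ℝ := stdNormal.real {z | 1 - a < Phi (z + r)}

/-- Away from the end points the rejection region is a half-line. Defining the power by a set also
covers `a = 0` and `a = 1`, where no such `q` exists: `Phi` lies strictly between 0 and 1, so the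
region is empty or everything. -/
theorem normalPower_of_Phi_eq {q a : ℝ} (h : Phi q = 1 - a) (r : ℝ) :
    normalPower r a = 1 - Phi (q - r) := by
  rw [normalPower, ← stdNormal_real_Ioi, ← h]
  congr 1
  ext z
  simp [Phi_strictMono.lt_iff_lt, sub_lt_iff_lt_add]

theorem normalPower_zero_right (r : ℝ) : normalPower r 0 = 0 := by
  have : {z | 1 - 0 < Phi (z + r)} = ∅ := by
    ext z
    simpa using (Phi_lt_one (z + r)).le
  rw [normalPower, this]
  simp

theorem normalPower_one_right (r : ℝ) : normalPower r 1 = 1 := by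
  have : {z | 1 - 1 < Phi (z + r)} = Set.univ := by
    ext z
    simpa using Phi_pos (z + r)
  rw [normalPower, this]
  simp

theorem normalPower_zero_left {a : ℝ} (ha : a ∈ Set.Icc (0 : ℝ) 1) : normalPower 0 a = a := by
  rcases ha.1.eq_or_lt with rfl | h0
  · exact normalPower_zero_right 0
  rcases ha.2.eq_or_lt with rfl | h1
  · exact normalPower_one_right 0
  obtain ⟨q, hq⟩ := exists_Phi_eq (sub_pos.2 h1) (sub_lt_self 1 h0)
  rw [normalPower_of_Phi_eq hq, sub_zero, hq, sub_sub_cancel]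

theorem normalPower_mono {r r' a a' : ℝ} (hr : r ≤ r') (ha : a ≤ a') :
    normalPower r a ≤ normalPower r' a' := by
  refine measureReal_mono fun z hz => ?_
  simp only [Set.mem_ofPred_eq] at hz ⊢
  have := Phi_strictMono.monotone (show z + r ≤ z + r' by linarith)
  linarith

theorem normalPower_eq_one_sub_gaussianTradeoff (r : ℝ) {a : ℝ} (ha : a ∈ Set.Icc (0 : ℝ) 1) :
    normalPower r a = 1 - gaussianTradeoff r a := by
  rcases ha.1.eq_or_lt with rfl | h0
  · simp [gaussianTradeoff, normalPower_zero_right]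
  rcases ha.2.eq_or_lt with rfl | h1
  · simp [gaussianTradeoff, normalPower_one_right, zero_lt_one.not_ge]
  obtain ⟨q, hq⟩ := exists_Phi_eq (sub_pos.2 h1) (sub_lt_self 1 h0)
  rw [normalPower_of_Phi_eq hq, gaussianTradeoff, if_neg h0.not_ge, if_neg h1.not_ge, ← hq,
    normalQuantile_Phi]

/-! ### Tests -/

/-- A measurable function with values in `[0, 1]`. -/
structure IsTest {Ω : Type*} [MeasurableSpace Ω] (φ : Ω → ℝ) : Prop where
  measurable : Measurable φ
  mem_Icc : ∀ w, φ w ∈ Set.Icc (0 : ℝ) 1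

namespace IsTest

variable {Ω Ω' : Type*} [MeasurableSpace Ω] [MeasurableSpace Ω']

theorem comp {φ : Ω → ℝ} (h : IsTest φ) {g : Ω' → Ω} (hg : Measurable g) :
    IsTest fun w => φ (g w) :=
  ⟨h.measurable.comp hg, fun _ => h.mem_Icc _⟩

theorem integrable {φ : Ω → ℝ} (h : IsTest φ) (P : Measure Ω) [IsFiniteMeasure P] :
    Integrable φ P :=
  Integrable.of_bound h.measurable.aestronglyMeasurable 1 (Filter.Eventually.of_forall fun _ => by
    rw [Real.norm_eq_abs, abs_of_nonneg (h.mem_Icc _).1]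
    exact (h.mem_Icc _).2)

theorem integral_mem_Icc {φ : Ω → ℝ} (h : IsTest φ) (P : Measure Ω) [IsProbabilityMeasure P] :
    ∫ w, φ w ∂P ∈ Set.Icc (0 : ℝ) 1 := by
  refine ⟨integral_nonneg fun w => (h.mem_Icc w).1, ?_⟩
  have := integral_mono (h.integrable P) (integrable_const 1) fun w => (h.mem_Icc w).2
  simpa using this

theorem integral_right {φ : Ω × Ω' → ℝ} (h : IsTest φ) (P : Measure Ω') [IsProbabilityMeasure P] :
    IsTest fun w => ∫ w', φ (w, w') ∂P :=
  ⟨h.measurable.stronglyMeasurable.integral_prod_right'.measurable, fun w =>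
    (h.comp (g := fun w' => (w, w')) (by fun_prop)).integral_mem_Icc P⟩

theorem integral_left {φ : Ω × Ω' → ℝ} (h : IsTest φ) (P : Measure Ω) [IsProbabilityMeasure P] :
    IsTest fun w' => ∫ w, φ (w, w') ∂P :=
  (h.comp (g := fun p : Ω' × Ω => (p.2, p.1)) (by fun_prop)).integral_right P

theorem indicator {s : Set Ω} (hs : MeasurableSet s) : IsTest (s.indicator (1 : Ω → ℝ)) := by
  refine ⟨measurable_one.indicator hs, fun w => ?_⟩
  by_cases hw : w ∈ s <;> simp [hw]

end IsTest

/-- Distinguishing `Q` from `P` is at least as hard as distinguishing `N(r, 1)` from `N(0, 1)`. -/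
def TestBound {Ω : Type*} [MeasurableSpace Ω] (r : ℝ) (P Q : Measure Ω) : Prop :=
  ∀ φ : Ω → ℝ, IsTest φ → ∫ w, φ w ∂Q ≤ normalPower r (∫ w, φ w ∂P)

theorem TestBound.mono {Ω : Type*} [MeasurableSpace Ω] {r r' : ℝ} {P Q : Measure Ω}
    (h : TestBound r P Q) (hr : r ≤ r') : TestBound r' P Q := fun φ hφ =>
  (h φ hφ).trans (normalPower_mono hr le_rfl)

theorem TestBound.refl {Ω : Type*} [MeasurableSpace Ω] (P : Measure Ω) [IsProbabilityMeasure P]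
    {r : ℝ} (hr : 0 ≤ r) : TestBound r P P := by
  refine TestBound.mono (fun φ hφ => ?_) hr
  rw [normalPower_zero_left (hφ.integral_mem_Icc P)]

/-! ### Shifts of a standard normal vector -/

/-- Completing the square in the exponent gives the likelihood ratio of a shift. -/
theorem gaussianReal_eq_withDensity_stdNormal (m : ℝ) :
    gaussianReal m 1 = stdNormal.withDensity fun x =>
      ENNReal.ofReal (Real.exp (m * x - m ^ 2 / 2)) := by
  rw [gaussianReal_of_var_ne_zero _ one_ne_zero, stdNormal, gaussianReal_of_var_ne_zero _ one_ne_zero,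
    ← withDensity_mul _ (measurable_gaussianPDF 0 1) (by fun_prop)]
  congr 1
  ext x
  simp only [gaussianPDF, Pi.mul_apply]
  rw [← ENNReal.ofReal_mul (gaussianPDFReal_nonneg _ _ _), gaussianPDFReal, gaussianPDFReal,
    mul_assoc (_⁻¹ : ℝ) (Real.exp _) (Real.exp _), ← Real.exp_add]
  congr 3
  simp
  ring

/-- The coordinates are independent under a product measure, so the integral of the product density
over a box factorizes. -/
theorem pi_withDensity {ι : Type*} [Fintype ι] (P : ι → Measure ℝ) [∀ i, IsProbabilityMeasure (P i)]
    (f : ι → ℝ → ENNReal) (hf : ∀ i, Measurable (f i))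
    [∀ i, SigmaFinite ((P i).withDensity (f i))] :
    Measure.pi (fun i => (P i).withDensity (f i)) =
      (Measure.pi P).withDensity fun x => ∏ i, f i (x i) := by
  refine Measure.pi_eq fun s hs => ?_
  rw [withDensity_apply _ (MeasurableSet.univ_pi hs),
    ← lintegral_indicator (MeasurableSet.univ_pi hs)]
  have hind : ∀ x : ι → ℝ, (Set.univ.pi s).indicator (fun x => ∏ i, f i (x i)) x =
      ∏ i, (s i).indicator (f i) (x i) := by
    intro x
    by_cases hx : x ∈ Set.univ.pi s
    · rw [Set.indicator_of_mem hx]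
      exact Finset.prod_congr rfl fun i _ => (Set.indicator_of_mem (hx i trivial) _).symm
    · rw [Set.indicator_of_notMem hx]
      simp only [Set.mem_pi, Set.mem_univ, true_implies, not_forall] at hx
      obtain ⟨i, hi⟩ := hx
      exact (Finset.prod_eq_zero (Finset.mem_univ i) (Set.indicator_of_notMem hi _)).symm
  simp_rw [hind]
  have hm : ∀ i, Measurable ((s i).indicator (f i)) := fun i => (hf i).indicator (hs i)
  rw [lintegral_prod_eq_prod_lintegral_of_indepFun (μ := Measure.pi P) Finset.univ
    (fun i x => (s i).indicator (f i) (x i))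
    (iIndepFun_pi fun i => (hm i).aemeasurable) fun i => (hm i).comp (measurable_pi_apply i)]
  refine Finset.prod_congr rfl fun i _ => ?_
  rw [withDensity_apply _ (hs i), ← lintegral_indicator (hs i)]
  exact (measurePreserving_eval P i).lintegral_comp (hm i)

/-- The law of a vector of independent standard normal variables. -/
abbrev stdNormalPi (ι : Type*) [Fintype ι] : Measure (ι → ℝ) := Measure.pi fun _ => stdNormal

variable {ι : Type*} [Fintype ι]

theorem map_add_stdNormalPi (v : ι → ℝ) :
    (stdNormalPi ι).map (fun x => x + v) = (stdNormalPi ι).withDensity fun x =>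
      ENNReal.ofReal (Real.exp (∑ i, v i * x i - (∑ i, v i ^ 2) / 2)) := by
  have h1 : (stdNormalPi ι).map (fun x => x + v) = Measure.pi fun i => gaussianReal (v i) 1 := by
    have (i : ι) : SigmaFinite (stdNormal.map fun x => x + v i) := by
      rw [gaussianReal_map_add_const]; infer_instance
    have := Measure.pi_map_pi (X := fun _ : ι => ℝ) (Y := fun _ : ι => ℝ)
      (μ := fun _ : ι => stdNormal) (f := fun i x => x + v i) (hμ := this)
      (fun i => (by fun_prop : AEMeasurable (fun x : ℝ => x + v i) stdNormal))
    simp only [stdNormal, gaussianReal_map_add_const, zero_add] at this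
    exact this
  have (i : ι) : SigmaFinite (stdNormal.withDensity fun x =>
      ENNReal.ofReal (Real.exp (v i * x - v i ^ 2 / 2))) := by
    rw [← gaussianReal_eq_withDensity_stdNormal]; infer_instance
  rw [h1]
  simp_rw [fun i => gaussianReal_eq_withDensity_stdNormal (v i)]
  rw [pi_withDensity (fun _ => stdNormal)
    (fun i x => ENNReal.ofReal (Real.exp (v i * x - v i ^ 2 / 2))) fun i => by fun_prop]
  congr 1
  ext x
  rw [← ENNReal.ofReal_prod_of_nonneg fun i _ => (Real.exp_pos _).le, ← Real.exp_sum,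
    Finset.sum_sub_distrib, Finset.sum_div]

/-- This is the law of the log-likelihood ratio up to a constant. It computes the level and the
power of the half-space test. -/
theorem map_dotProduct_stdNormalPi (v : ι → ℝ) :
    (stdNormalPi ι).map (fun x => v ⬝ᵥ x) = gaussianReal 0 (∑ i, v i ^ 2).toNNReal := by
  classical
  have h := IsGaussian.map_eq_gaussianReal (μ := stdGaussian (EuclideanSpace ℝ ι))
    (innerSL ℝ (WithLp.toLp 2 v))
  rw [variance_dual_stdGaussian, integral_strongDual_stdGaussian, innerSL_apply_norm,
    EuclideanSpace.real_norm_sq_eq, ← map_pi_eq_stdGaussian,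
    Measure.map_map (by fun_prop) (by fun_prop)] at h
  rw [← h]
  congr 1
  ext x
  simp [PiLp.inner_apply, dotProduct, mul_comm]

/-- Neyman–Pearson: the likelihood ratio increases with `v ⬝ᵥ x`, so no test beats the half-space
test of the same level. Along `v` the problem is one-dimensional with shift `s`, the length of `v`.
-/
theorem testBound_stdNormalPi (v : ι → ℝ) {r : ℝ} (hr : 0 ≤ r) (hv : ∑ i, v i ^ 2 ≤ r ^ 2) :
    TestBound r (stdNormalPi ι) ((stdNormalPi ι).map fun x => x + v) := by
  have hs0 : 0 ≤ ∑ i, v i ^ 2 := Finset.sum_nonneg fun i _ => sq_nonneg _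
  obtain ⟨s, hs, hsv⟩ : ∃ s : ℝ, 0 ≤ s ∧ ∑ i, v i ^ 2 = s ^ 2 :=
    ⟨√(∑ i, v i ^ 2), Real.sqrt_nonneg _, (Real.sq_sqrt hs0).symm⟩
  have hsr : s ≤ r := by
    rw [hsv] at hv
    exact (sq_le_sq₀ hs hr).1 hv
  refine TestBound.mono ?_ hsr
  rcases hs.eq_or_lt with rfl | hspos
  · have : v = 0 := by
      funext i
      have := (Finset.sum_eq_zero_iff_of_nonneg fun i _ => sq_nonneg (v i)).1 (by simpa using hsv) i
        (Finset.mem_univ i)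
      simpa using this
    subst this
    simpa using TestBound.refl (stdNormalPi ι) le_rfl
  intro φ hφ
  set γ := stdNormalPi ι
  set Lr : (ι → ℝ) → ℝ := fun x => Real.exp (v ⬝ᵥ x - s ^ 2 / 2) with hLr
  have hLrm : Measurable Lr := by
    unfold Lr dotProduct
    fun_prop
  have hmap : γ.map (fun x => x + v) = γ.withDensity fun x => ENNReal.ofReal (Lr x) := by
    rw [map_add_stdNormalPi, hsv]
    rfl
  have hint : ∀ f : (ι → ℝ) → ℝ, ∫ x, f x ∂(γ.map fun x => x + v) = ∫ x, Lr x * f x ∂γ := by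
    intro f
    rw [hmap, integral_withDensity_eq_integral_toReal_smul (by fun_prop)
      (Filter.Eventually.of_forall fun _ => ENNReal.ofReal_lt_top)]
    refine integral_congr_ae (Filter.Eventually.of_forall fun x => ?_)
    simp [ENNReal.toReal_ofReal (Real.exp_pos _).le, hLr]
  have hprob : IsProbabilityMeasure (γ.map fun x => x + v) :=
    Measure.isProbabilityMeasure_map (by fun_prop)
  have hLint : Integrable Lr γ := by
    refine ⟨hLrm.aestronglyMeasurable, ?_⟩
    rw [hasFiniteIntegral_iff_ofReal (Filter.Eventually.of_forall fun x => (Real.exp_pos _).le)]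
    have := hprob.measure_univ
    rw [hmap, withDensity_apply _ MeasurableSet.univ, Measure.restrict_univ] at this
    rw [this]
    exact ENNReal.one_lt_top
  have hLφ : ∀ ψ : (ι → ℝ) → ℝ, IsTest ψ → Integrable (fun x => Lr x * ψ x) γ := fun ψ hψ =>
    hLint.mul_bdd (c := 1) hψ.measurable.aestronglyMeasurable
      (Filter.Eventually.of_forall fun x => by
        rw [Real.norm_eq_abs, abs_of_nonneg (hψ.mem_Icc x).1]; exact (hψ.mem_Icc x).2)
  have ha := hφ.integral_mem_Icc γ
  rcases ha.2.eq_or_lt with h1 | h1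
  · rw [h1, normalPower_one_right]
    exact (hφ.integral_mem_Icc _).2
  rcases ha.1.eq_or_lt with h0 | h0
  -- A test of level 0 vanishes almost everywhere, and the shifted law has a density.
  · rw [← h0, normalPower_zero_right, hint]
    have hz : φ =ᵐ[γ] 0 := (integral_eq_zero_iff_of_nonneg (fun x => (hφ.mem_Icc x).1)
      (hφ.integrable γ)).1 h0.symm
    refine (integral_eq_zero_of_ae ?_).le
    filter_upwards [hz] with x hx
    simp [hx]
  obtain ⟨q, hq⟩ := exists_Phi_eq (sub_pos.2 h1) (sub_lt_self 1 h0)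
  rw [normalPower_of_Phi_eq hq]
  have hlaw : ∀ c : ℝ, γ.real {x | s * c < v ⬝ᵥ x} = 1 - Phi c := by
    intro c
    have hm : Measurable fun x : ι → ℝ => v ⬝ᵥ x := by unfold dotProduct; fun_prop
    have hsc : gaussianReal 0 (s ^ 2).toNNReal = stdNormal.map fun z => s * z := by
      rw [stdNormal, gaussianReal_map_const_mul]
      congr 1
      · simp
      · ext; simp [sq_nonneg]
    have : {x : ι → ℝ | s * c < v ⬝ᵥ x} = (fun x => v ⬝ᵥ x) ⁻¹' Set.Ioi (s * c) := rfl
    rw [this, ← map_measureReal_apply hm measurableSet_Ioi, map_dotProduct_stdNormalPi, hsv, hsc,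
      map_measureReal_apply (by fun_prop) measurableSet_Ioi, ← stdNormal_real_Ioi]
    congr 1
    ext z
    simp [mul_lt_mul_iff_right₀ hspos]
  have hdm : Measurable fun x : ι → ℝ => v ⬝ᵥ x := by unfold dotProduct; fun_prop
  -- The half-space with exactly the level of `φ`; translating by `v` moves its normalized threshold
  -- from `q` to `q - s`.
  set A : Set (ι → ℝ) := {x | s * q < v ⬝ᵥ x} with hA
  have hAm : MeasurableSet A := measurableSet_lt measurable_const hdm
  have hψ : IsTest (A.indicator (1 : (ι → ℝ) → ℝ)) := IsTest.indicator hAm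
  have hψγ : ∫ x, A.indicator 1 x ∂γ = ∫ x, φ x ∂γ := by
    rw [integral_indicator_one hAm, hlaw, hq, sub_sub_cancel]
  have hψγ' : ∫ x, A.indicator 1 x ∂(γ.map fun x => x + v) = 1 - Phi (q - s) := by
    rw [integral_indicator_one hAm, map_measureReal_apply (by fun_prop) hAm, ← hlaw]
    congr 1
    ext x
    have : v ⬝ᵥ v = s ^ 2 := by rw [← hsv]; simp [dotProduct, sq]
    simp only [hA, Set.mem_preimage, Set.mem_ofPred_eq, dotProduct_add, this]
    constructor <;> intro h <;> linarith
  rw [← hψγ', hint, hint]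
  -- The likelihood ratio on the boundary of `A`. Since `Lr - k` is nonnegative on `A` and
  -- nonpositive off it, the indicator of `A` maximizes `(Lr - k) * φ` pointwise among tests.
  set k := Real.exp (s * q - s ^ 2 / 2)
  have hkey : ∀ x, Lr x * φ x - k * φ x ≤ Lr x * A.indicator 1 x - k * A.indicator 1 x := by
    intro x
    have := hφ.mem_Icc x
    by_cases hx : x ∈ A
    · have hk : k ≤ Lr x := Real.exp_le_exp.2 (by have : s * q < v ⬝ᵥ x := hx; linarith)
      simp only [hx, Set.indicator_of_mem, Pi.one_apply]
      nlinarith [this.2]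
    · have hk : Lr x ≤ k := Real.exp_le_exp.2 (by have : ¬ s * q < v ⬝ᵥ x := hx; linarith)
      simp only [hx, not_false_eq_true, Set.indicator_of_notMem]
      nlinarith [this.1]
  have hmono := integral_mono ((hLφ φ hφ).sub ((hφ.integrable γ).const_mul k))
    ((hLφ _ hψ).sub ((hψ.integrable γ).const_mul k)) hkey
  simp only [Pi.sub_apply] at hmono
  rw [integral_sub (hLφ φ hφ) ((hφ.integrable γ).const_mul k),
    integral_sub (hLφ _ hψ) ((hψ.integrable γ).const_mul k), integral_const_mul,
    integral_const_mul, hψγ] at hmono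
  linarith

/-! ### Adaptive composition -/

theorem integral_integral_add_le_normalPower {χ : ℝ × ℝ → ℝ} (hχ : IsTest χ) (s r : ℝ) :
    ∫ z, ∫ w, χ (w + s, z + r) ∂stdNormal ∂stdNormal ≤
      normalPower √(s ^ 2 + r ^ 2) (∫ z, ∫ w, χ (w, z) ∂stdNormal ∂stdNormal) := by
  have hE := measurePreserving_finTwoArrow stdNormal
  have key : ∀ f : ℝ × ℝ → ℝ, IsTest f → ∫ z, ∫ w, f (w, z) ∂stdNormal ∂stdNormal =
      ∫ x, f (x 0, x 1) ∂(stdNormalPi (Fin 2)) := by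
    intro f hf
    rw [← integral_prod_symm _ (hf.integrable _), ← hE.integral_comp' (g := f)]
    rfl
  rw [key χ hχ, key (fun p => χ (p.1 + s, p.2 + r)) (hχ.comp (by fun_prop))]
  have h := testBound_stdNormalPi ![s, r] (Real.sqrt_nonneg (s ^ 2 + r ^ 2))
    (by rw [Real.sq_sqrt (by positivity)]; simp) (fun x => χ (x 0, x 1)) (hχ.comp (by fun_prop))
  rw [integral_map (by fun_prop)
    (hχ.comp (by fun_prop)).measurable.aestronglyMeasurable] at h
  exact h

/-- Adaptive composition: an observation `x` of law `P` or `Q` is followed by a test whose power is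
`a x` or `b x`. -/
theorem TestBound.integral_le {Ω : Type*} [MeasurableSpace Ω] {s r : ℝ} {P Q : Measure Ω}
    [IsProbabilityMeasure P] [IsProbabilityMeasure Q] (h : TestBound s P Q) {a b : Ω → ℝ}
    (ha : IsTest a) (hb : IsTest b) (hab : ∀ x, b x ≤ normalPower r (a x)) :
    ∫ x, b x ∂Q ≤ normalPower √(s ^ 2 + r ^ 2) (∫ x, a x ∂P) := by
  -- The second stage becomes an optimal test on a normal observation `z`: given `x`, it rejects
  -- with probability `a x` under `N(0, 1)` and `normalPower r (a x)` under `N(r, 1)`.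
  set ψ : Ω × ℝ → ℝ := {p : Ω × ℝ | 1 - a p.1 < Phi p.2}.indicator 1 with hψd
  have hψ : IsTest ψ := IsTest.indicator (measurableSet_lt
    (measurable_const.sub (ha.measurable.comp measurable_fst))
    (measurable_Phi.comp measurable_snd))
  have hψr : IsTest fun p : Ω × ℝ => ψ (p.1, p.2 + r) := hψ.comp (by fun_prop)
  have hsec : ∀ (t c : ℝ), ∫ z, {z | 1 - c < Phi z}.indicator (1 : ℝ → ℝ) (z + t) ∂stdNormal =
      normalPower t c := by
    intro t c
    have hm : MeasurableSet {z | 1 - c < Phi (z + t)} :=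
      measurableSet_lt measurable_const (measurable_Phi.comp (by fun_prop))
    rw [normalPower, ← integral_indicator_one hm]
    rfl
  have hψz : ∀ x t, ∫ z, ψ (x, z + t) ∂stdNormal = normalPower t (a x) := fun x t => hsec t (a x)
  -- By Fubini `z` can be frozen first. What remains is a test of `P` against `Q` of level `A z`,
  -- which `h` allows to be replaced by an optimal test `χ` on a second normal observation `w`.
  set A : ℝ → ℝ := fun z => ∫ x, ψ (x, z) ∂P with hAd
  have hA : IsTest A := hψ.integral_left P
  set χ : ℝ × ℝ → ℝ := {p : ℝ × ℝ | 1 - A p.2 < Phi p.1}.indicator 1 with hχd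
  have hχ : IsTest χ := IsTest.indicator (measurableSet_lt
    (measurable_const.sub (hA.measurable.comp measurable_snd))
    (measurable_Phi.comp measurable_fst))
  have hχw : ∀ z t, ∫ w, χ (w + t, z) ∂stdNormal = normalPower t (A z) := fun z t => hsec t (A z)
  have hχA : ∫ z, ∫ w, χ (w, z) ∂stdNormal ∂stdNormal = ∫ x, a x ∂P := by
    have h1 : ∀ z, ∫ w, χ (w, z) ∂stdNormal = A z := fun z => by
      have := hχw z 0
      simp only [add_zero] at this
      rw [this, normalPower_zero_left (hA.mem_Icc z)]
    simp_rw [h1, hAd]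
    rw [← integral_prod_symm ψ (hψ.integrable (P.prod stdNormal)),
      integral_prod ψ (hψ.integrable (P.prod stdNormal))]
    refine integral_congr_ae (Filter.Eventually.of_forall fun x => ?_)
    have := hψz x 0
    simp only [add_zero] at this
    simp only [this, normalPower_zero_left (ha.mem_Icc x)]
  calc ∫ x, b x ∂Q ≤ ∫ x, ∫ z, ψ (x, z + r) ∂stdNormal ∂Q :=
        integral_mono (hb.integrable Q) ((hψr.integral_right stdNormal).integrable Q) fun x => by
          simp only [hψz]
          exact hab x
    _ = ∫ z, ∫ x, ψ (x, z + r) ∂Q ∂stdNormal := by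
        rw [← integral_prod_symm _ (hψr.integrable (Q.prod stdNormal)),
          integral_prod _ (hψr.integrable (Q.prod stdNormal))]
    _ ≤ ∫ z, ∫ w, χ (w + s, z + r) ∂stdNormal ∂stdNormal :=
        integral_mono ((hψr.integral_left Q).integrable _)
          (((hχ.comp (g := fun p : ℝ × ℝ => (p.1 + s, p.2 + r)) (by fun_prop)).integral_left
            stdNormal).integrable _) fun z => by
          simp only [hχw]
          exact h _ (hψ.comp (g := fun x => (x, z + r)) (by fun_prop))
    _ ≤ _ := by
        rw [← hχA]
        exact integral_integral_add_le_normalPower hχ s r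

/-! ### Shifts of the noise -/

theorem normal_eq_map (σ : ℝ) : normal σ = stdNormal.map fun z => σ * z := by
  rw [normal, stdNormal, gaussianReal_map_const_mul]
  congr 1
  · simp
  · ext; simp [sq_nonneg]

theorem testBound_pi_normal {ι : Type*} [Fintype ι] {σ r : ℝ} (v : ι → ℝ) (hr : 0 ≤ r)
    (hv : ∑ i, v i ^ 2 ≤ (r * σ) ^ 2) :
    TestBound r (Measure.pi fun _ : ι => normal σ)
      ((Measure.pi fun _ : ι => normal σ).map fun x => x + v) := by
  by_cases hv0 : v = 0
  · subst hv0
    simpa using TestBound.refl (Measure.pi fun _ : ι => normal σ) hr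
  -- With zero variance the hypothesis `hv` forces `v = 0`, already settled.
  have hσ : σ ≠ 0 := by
    rintro rfl
    refine hv0 (funext fun i => ?_)
    have h0 := (Finset.sum_nonneg fun i _ => sq_nonneg (v i) : 0 ≤ ∑ i, v i ^ 2)
    have := (Finset.sum_eq_zero_iff_of_nonneg fun i _ => sq_nonneg (v i)).1
      (le_antisymm (by simpa using hv) h0) i (Finset.mem_univ i)
    simpa using this
  have hmap : (Measure.pi fun _ : ι => normal σ) = (stdNormalPi ι).map fun x => σ • x := by
    have (i : ι) : SigmaFinite (stdNormal.map fun z => σ * z) := by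
      rw [← normal_eq_map]; infer_instance
    have := Measure.pi_map_pi (X := fun _ : ι => ℝ) (Y := fun _ : ι => ℝ)
      (μ := fun _ : ι => stdNormal) (f := fun _ z => σ * z) (hμ := this)
      (fun _ => by fun_prop)
    rw [normal_eq_map]
    exact this.symm
  intro φ hφ
  have h := testBound_stdNormalPi (fun i => v i / σ) hr
    (by
      simp_rw [div_pow]
      rw [← Finset.sum_div, div_le_iff₀ (by positivity), ← mul_pow]
      exact hv) (fun x => φ (σ • x)) (hφ.comp (by fun_prop))
  rw [integral_map (by fun_prop) (hφ.comp (by fun_prop)).measurable.aestronglyMeasurable] at h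
  rw [integral_map (by fun_prop) hφ.measurable.aestronglyMeasurable, hmap,
    integral_map (by fun_prop) hφ.measurable.aestronglyMeasurable,
    integral_map (by fun_prop) (hφ.comp (by fun_prop)).measurable.aestronglyMeasurable]
  convert h using 6 with x
  ext i
  simp
  field_simp

/-- Independence is a special case of adaptive composition: the matrix noise is observed first, and
the vector noise is tested next. -/
theorem testBound_noise {d : ℕ} {σ₁ σ₂ r₁ r₂ : ℝ} (δ : (Sym2 (Fin d) → ℝ) × (Fin d → ℝ))
    (hr₁ : 0 ≤ r₁) (hr₂ : 0 ≤ r₂) (h₁ : ∑ e, δ.1 e ^ 2 ≤ (r₁ * σ₁) ^ 2)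
    (h₂ : ∑ i, δ.2 i ^ 2 ≤ (r₂ * σ₂) ^ 2) :
    TestBound √(r₁ ^ 2 + r₂ ^ 2) (noise d σ₁ σ₂ : Measure _)
      ((noise d σ₁ σ₂ : Measure _).map fun ξ => ξ + δ) := by
  intro φ hφ
  rw [integral_map (by fun_prop) hφ.measurable.aestronglyMeasurable]
  set γ₁ := Measure.pi fun _ : Sym2 (Fin d) => normal σ₁
  set γ₂ := Measure.pi fun _ : Fin d => normal σ₂
  have hγ : (noise d σ₁ σ₂ : Measure _) = γ₁.prod γ₂ := rfl
  have hφδ : IsTest fun ξ => φ (ξ + δ) := hφ.comp (by fun_prop)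
  rw [hγ, integral_prod _ (hφ.integrable _), integral_prod _ (hφδ.integrable _)]
  have : IsProbabilityMeasure (γ₁.map fun x => x + δ.1) :=
    Measure.isProbabilityMeasure_map (by fun_prop)
  have hbt : IsTest fun p : (Sym2 (Fin d) → ℝ) × (Fin d → ℝ) => φ (p.1, p.2 + δ.2) :=
    hφ.comp (by fun_prop)
  have h := (testBound_pi_normal δ.1 hr₁ h₁).integral_le (hφ.integral_right γ₂)
    (hbt.integral_right γ₂) (r := r₂) fun x => by
      have := testBound_pi_normal δ.2 hr₂ h₂ (fun y => φ (x, y)) (hφ.comp (by fun_prop))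
      rwa [integral_map (by fun_prop) (hφ.comp (by fun_prop)).measurable.aestronglyMeasurable]
        at this
  rwa [integral_map (by fun_prop)
    (hbt.integral_right γ₂).measurable.aestronglyMeasurable] at h

/-! ### Sensitivity of the gradient and of the Hessian -/

theorem l2norm_nonneg {d : ℕ} (v : Fin d → ℝ) : 0 ≤ l2norm v := norm_nonneg _

theorem l2norm_smul {d : ℕ} (c : ℝ) (v : Fin d → ℝ) : l2norm (c • v) = |c| * l2norm v := by
  rw [l2norm, WithLp.toLp_smul, norm_smul, Real.norm_eq_abs, l2norm]

theorem l2norm_sub_le {d : ℕ} (v w : Fin d → ℝ) : l2norm (v - w) ≤ l2norm v + l2norm w := by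
  rw [l2norm, WithLp.toLp_sub]
  exact norm_sub_le _ _

theorem sum_sq_eq_l2norm_sq {d : ℕ} (v : Fin d → ℝ) : ∑ i, v i ^ 2 = l2norm v ^ 2 := by
  rw [l2norm_sq]
  simp [dotProduct, sq]

theorem l2norm_truncate_le {d : ℕ} {R : ℝ} (hR : 0 ≤ R) (v : Fin d → ℝ) :
    l2norm (truncate R v) ≤ R := by
  unfold truncate
  split_ifs with h
  · rw [l2norm_smul, abs_of_nonneg (div_nonneg hR (l2norm_nonneg v))]
    rw [div_mul_eq_mul_div]
    exact div_le_of_le_mul₀ (l2norm_nonneg v) hR le_rfl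
  · exact (not_le.1 h).le

theorem l2norm_transform_le {d n m : ℕ} (η : ℝ) (B : Fin m → Fin d → ℝ) (A : Fin n → Fin d → ℝ)
    (i : Fin n) : l2norm (transform η B A i) ≤ radius d n η :=
  l2norm_truncate_le (Real.sqrt_nonneg _) _

theorem sum_sub_sum_of_eq {n : ℕ} {V : Type*} [AddCommGroup V] {f g : Fin n → V} (i : Fin n)
    (h : ∀ j, j ≠ i → f j = g j) : ∑ j, f j - ∑ j, g j = f i - g i := by
  rw [← Finset.sum_sub_distrib]
  exact Finset.sum_eq_single i (fun j _ hj => sub_eq_zero.2 (h j hj)) (by simp)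

theorem abs_label_sub_sigmoid_le (y : Fin 2) (x : ℝ) :
    |((y : ℕ) : ℝ) - Real.sigmoid x| ≤ 1 := by
  have h0 := Real.sigmoid_pos x
  have h1 := Real.sigmoid_lt_one x
  rw [abs_le]
  fin_cases y <;> constructor <;> simp <;> linarith

section Neighbours

variable {d n : ℕ} (lam : ℝ) (S : Matrix (Fin d) (Fin d) ℝ) {X X' : Fin n → Fin d → ℝ}
  {y y' : Fin n → Fin 2} {i : Fin n} {R : ℝ}

/-- Only the changed sample survives in the difference, since the regularizer is public. Its old and
new contributions each have norm at most `R / n`. -/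
theorem gradLoss_sensitivity (hX : ∀ j, j ≠ i → X j = X' j) (hy : ∀ j, j ≠ i → y j = y' j)
    (hR : ∀ j, l2norm (X j) ≤ R) (hR' : ∀ j, l2norm (X' j) ≤ R) (β : Fin d → ℝ) :
    ∑ k, (gradLoss lam S X' y' β - gradLoss lam S X y β) k ^ 2 ≤ (2 * R / n) ^ 2 := by
  have hterm : ∀ (x : Fin d → ℝ) (z : Fin 2), l2norm x ≤ R →
      l2norm ((((z : ℕ) : ℝ) - Real.sigmoid (x ⬝ᵥ β)) • x) ≤ R := by
    intro x z hx
    rw [l2norm_smul]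
    exact (mul_le_of_le_one_left (l2norm_nonneg x) (abs_label_sub_sigmoid_le z _)).trans hx
  have hdiff : gradLoss lam S X' y' β - gradLoss lam S X y β = (n : ℝ)⁻¹ •
      ((((y i : ℕ) : ℝ) - Real.sigmoid (X i ⬝ᵥ β)) • X i -
        (((y' i : ℕ) : ℝ) - Real.sigmoid (X' i ⬝ᵥ β)) • X' i) := by
    have := sum_sub_sum_of_eq (f := fun j => (((y j : ℕ) : ℝ) - Real.sigmoid (X j ⬝ᵥ β)) • X j)
      (g := fun j => (((y' j : ℕ) : ℝ) - Real.sigmoid (X' j ⬝ᵥ β)) • X' j) i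
      fun j hj => by rw [hX j hj, hy j hj]
    rw [← this, gradLoss, gradLoss, smul_sub]
    abel
  rw [sum_sq_eq_l2norm_sq, hdiff, l2norm_smul]
  have h := l2norm_sub_le ((((y i : ℕ) : ℝ) - Real.sigmoid (X i ⬝ᵥ β)) • X i)
    ((((y' i : ℕ) : ℝ) - Real.sigmoid (X' i ⬝ᵥ β)) • X' i)
  have h1 := hterm (X i) (y i) (hR i)
  have h2 := hterm (X' i) (y' i) (hR' i)
  refine pow_le_pow_left₀ (mul_nonneg (abs_nonneg _) (l2norm_nonneg _)) ?_ 2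
  rw [abs_of_nonneg (by positivity), div_eq_inv_mul]
  exact mul_le_mul_of_nonneg_left (by linarith) (by positivity)

theorem sum_sq_sub_vecMulVec (a b : ℝ) (u v : Fin d → ℝ) :
    ∑ k, ∑ l, (a * (u k * u l) - b * (v k * v l)) ^ 2 =
      a ^ 2 * (u ⬝ᵥ u) ^ 2 + b ^ 2 * (v ⬝ᵥ v) ^ 2 - 2 * a * b * (u ⬝ᵥ v) ^ 2 := by
  have h : ∀ x y : Fin d → ℝ, (x ⬝ᵥ y) ^ 2 = ∑ k, ∑ l, x k * y k * (x l * y l) := fun x y => by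
    rw [sq, dotProduct, Finset.sum_mul_sum]
  simp only [h, Finset.mul_sum, ← Finset.sum_add_distrib, ← Finset.sum_sub_distrib]
  exact Finset.sum_congr rfl fun k _ => Finset.sum_congr rfl fun l _ => by ring

/-- The logistic weights lie in `[0, 1/4]`, so each squared Frobenius norm is at most `R ^ 4 / 16`
before scaling. The cross term is dropped because it enters with a favourable sign; this is twice as
sharp as the triangle inequality. -/
theorem hessLoss_sensitivity (hX : ∀ j, j ≠ i → X j = X' j)
    (hR : ∀ j, l2norm (X j) ≤ R) (hR' : ∀ j, l2norm (X' j) ≤ R) (β : Fin d → ℝ) :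
    ∑ k, ∑ l, (hessLoss lam S X' β - hessLoss lam S X β) k l ^ 2 ≤ R ^ 4 / (8 * n ^ 2) := by
  set w : (Fin d → ℝ) → ℝ := fun x => Real.sigmoid (x ⬝ᵥ β) * (1 - Real.sigmoid (x ⬝ᵥ β)) with hw
  have hw0 : ∀ x, 0 ≤ w x := fun x =>
    mul_nonneg (Real.sigmoid_pos _).le (sub_nonneg.2 (Real.sigmoid_lt_one _).le)
  have hw4 : ∀ x, w x ≤ 1 / 4 := fun x => by
    nlinarith [sq_nonneg (Real.sigmoid (x ⬝ᵥ β) - 1 / 2)]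
  have hterm : ∀ x, l2norm x ≤ R → w x ^ 2 * (x ⬝ᵥ x) ^ 2 ≤ R ^ 4 / 16 := by
    intro x hx
    rw [← l2norm_sq, ← pow_mul]
    have h1 := pow_le_pow_left₀ (hw0 x) (hw4 x) 2
    have h2 := pow_le_pow_left₀ (l2norm_nonneg x) hx 4
    have := mul_le_mul h1 h2 (pow_nonneg (l2norm_nonneg x) 4) (by norm_num)
    linarith
  have hdiff : ∀ k l, (hessLoss lam S X' β - hessLoss lam S X β) k l ^ 2 = ((n : ℝ)⁻¹) ^ 2 *
      (w (X' i) * (X' i k * X' i l) - w (X i) * (X i k * X i l)) ^ 2 := by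
    intro k l
    have := sum_sub_sum_of_eq (f := fun j => w (X' j) • vecMulVec (X' j) (X' j))
      (g := fun j => w (X j) • vecMulVec (X j) (X j)) i fun j hj => by rw [hX j hj]
    have h2 : hessLoss lam S X' β - hessLoss lam S X β = (n : ℝ)⁻¹ •
        (w (X' i) • vecMulVec (X' i) (X' i) - w (X i) • vecMulVec (X i) (X i)) := by
      rw [← this, hessLoss, hessLoss, smul_sub, add_sub_add_right_eq_sub]
    rw [h2, ← mul_pow]
    simp [vecMulVec_apply]
  simp_rw [hdiff, ← Finset.mul_sum]
  rw [sum_sq_sub_vecMulVec]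
  have h1 := hterm (X' i) (hR' i)
  have h2 := hterm (X i) (hR i)
  have h3 : 0 ≤ 2 * w (X' i) * w (X i) * (X' i ⬝ᵥ X i) ^ 2 :=
    mul_nonneg (mul_nonneg (mul_nonneg zero_le_two (hw0 _)) (hw0 _)) (sq_nonneg _)
  calc _ ≤ ((n : ℝ)⁻¹) ^ 2 * (R ^ 4 / 8) := mul_le_mul_of_nonneg_left (by linarith) (sq_nonneg _)
    _ = _ := by ring

end Neighbours

theorem hessLoss_comm {d n : ℕ} (lam : ℝ) {S : Matrix (Fin d) (Fin d) ℝ} (hS : S.IsSymm)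
    (X : Fin n → Fin d → ℝ) (β : Fin d → ℝ) (k l : Fin d) :
    hessLoss lam S X β k l = hessLoss lam S X β l k := by
  have hS' : S⁻¹ k l = S⁻¹ l k := (hS.inv).apply l k
  simp only [hessLoss, Matrix.add_apply, Matrix.smul_apply, Matrix.sum_apply, vecMulVec_apply, hS']
  simp only [mul_comm (X _ k)]

/-- Choosing an ordered representative embeds unordered pairs into ordered ones. Hence the shift of
the independent entries is controlled by the Frobenius norm. -/
theorem sum_sym2_le {d : ℕ} (f : Sym2 (Fin d) → ℝ) (hf : ∀ e, 0 ≤ f e) :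
    ∑ e, f e ≤ ∑ k, ∑ l, f s(k, l) := by
  rw [← Finset.sum_product' (f := fun k l => f s(k, l)), Finset.univ_product_univ]
  calc ∑ e, f e = ∑ e : Sym2 (Fin d), f s((Quot.out e).1, (Quot.out e).2) :=
        Finset.sum_congr rfl fun e _ => congrArg f (Quot.out_eq e).symm
    _ = ∑ p ∈ Finset.univ.map ⟨fun e : Sym2 (Fin d) => Quot.out e,
          Function.LeftInverse.injective Quot.out_eq⟩, f s(p.1, p.2) := by
        rw [Finset.sum_map]
        rfl
    _ ≤ _ := Finset.sum_le_sum_of_subset_of_nonneg (Finset.subset_univ _) fun _ _ _ => hf _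

/-! ### Privacy of the noisy Newton method -/

section Neighbours

variable {d n : ℕ} (lam : ℝ) {S : Matrix (Fin d) (Fin d) ℝ} {X X' : Fin n → Fin d → ℝ}
  {y y' : Fin n → Fin 2} {i : Fin n} {R : ℝ}

/-- A Newton step on a neighbouring dataset is a Newton step with shifted noise. -/
theorem exists_newtonStep_eq_add (hS : S.IsSymm) (hX : ∀ j, j ≠ i → X j = X' j)
    (hy : ∀ j, j ≠ i → y j = y' j) (hR : ∀ j, l2norm (X j) ≤ R) (hR' : ∀ j, l2norm (X' j) ≤ R)
    (β : Fin d → ℝ) :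
    ∃ δ : (Sym2 (Fin d) → ℝ) × (Fin d → ℝ),
      (∀ ξ, newtonStep lam S X' y' (β, ξ) = newtonStep lam S X y (β, ξ + δ)) ∧
      ∑ e, δ.1 e ^ 2 ≤ R ^ 4 / (8 * n ^ 2) ∧ ∑ k, δ.2 k ^ 2 ≤ (2 * R / n) ^ 2 := by
  set Δ := hessLoss lam S X' β - hessLoss lam S X β with hΔ
  have hsymm : ∀ k l, Δ k l = Δ l k := fun k l => by
    rw [hΔ, Matrix.sub_apply, Matrix.sub_apply, hessLoss_comm lam hS X' β k l,
      hessLoss_comm lam hS X β k l]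
  -- The Hessian difference is symmetric, so it descends to unordered pairs and can be absorbed by
  -- the symmetric noise matrix.
  refine ⟨(Sym2.lift ⟨fun k l => Δ k l, hsymm⟩, gradLoss lam S X' y' β - gradLoss lam S X y β),
    fun ξ => ?_, ?_, gradLoss_sensitivity lam S hX hy hR hR' β⟩
  · have h1 : hessLoss lam S X β + symMatrix (ξ.1 + Sym2.lift ⟨fun k l => Δ k l, hsymm⟩) =
        hessLoss lam S X' β + symMatrix ξ.1 := by
      ext k l
      simp only [Matrix.add_apply, symMatrix, Matrix.of_apply, Pi.add_apply, Sym2.lift_mk, hΔ,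
        Matrix.sub_apply]
      ring
    have h2 : gradLoss lam S X y β + (ξ.2 + (gradLoss lam S X' y' β - gradLoss lam S X y β)) =
        gradLoss lam S X' y' β + ξ.2 := by
      abel
    simp only [newtonStep, Prod.fst_add, Prod.snd_add, h1, h2]
  · exact (sum_sym2_le _ fun e => sq_nonneg _).trans (hessLoss_sensitivity lam S hX hR hR' β)

/-- Induction by adaptive composition: the previous iterate is the first observation, and the fresh
noise, conditionally on it, supplies the second. -/
theorem testBound_iterateLaw (hS : S.IsSymm) (hX : ∀ j, j ≠ i → X j = X' j)
    (hy : ∀ j, j ≠ i → y j = y' j) (hR : ∀ j, l2norm (X j) ≤ R) (hR' : ∀ j, l2norm (X' j) ≤ R)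
    {σ₁ σ₂ r₁ r₂ : ℝ} (hr₁ : 0 ≤ r₁) (hr₂ : 0 ≤ r₂) (h₁ : R ^ 4 / (8 * n ^ 2) ≤ (r₁ * σ₁) ^ 2)
    (h₂ : (2 * R / n) ^ 2 ≤ (r₂ * σ₂) ^ 2) (t : ℕ) :
    TestBound √(t * (r₁ ^ 2 + r₂ ^ 2)) (iterateLaw lam S X y σ₁ σ₂ t : Measure (Fin d → ℝ))
      (iterateLaw lam S X' y' σ₁ σ₂ t : Measure (Fin d → ℝ)) := by
  induction t with
  | zero => exact TestBound.refl _ (Real.sqrt_nonneg _)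
  | succ t ih =>
    intro φ hφ
    have hstep : ∀ (X : Fin n → Fin d → ℝ) (y : Fin n → Fin 2),
        ∫ β, φ β ∂(iterateLaw lam S X y σ₁ σ₂ (t + 1) : Measure (Fin d → ℝ)) =
        ∫ β, ∫ ξ, φ (newtonStep lam S X y (β, ξ)) ∂(noise d σ₁ σ₂ : Measure _)
          ∂(iterateLaw lam S X y σ₁ σ₂ t : Measure (Fin d → ℝ)) := by
      intro X y
      have hm := measurable_newtonStep lam S X y
      have : (iterateLaw lam S X y σ₁ σ₂ (t + 1) : Measure (Fin d → ℝ)) =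
          ((iterateLaw lam S X y σ₁ σ₂ t : Measure (Fin d → ℝ)).prod
            (noise d σ₁ σ₂ : Measure _)).map (newtonStep lam S X y) := rfl
      rw [this, integral_map hm.aemeasurable hφ.measurable.aestronglyMeasurable,
        integral_prod _ ((hφ.comp hm).integrable _)]
    rw [hstep, hstep]
    have hc : (0 : ℝ) ≤ r₁ ^ 2 + r₂ ^ 2 := by positivity
    have h := ih.integral_le (r := √(r₁ ^ 2 + r₂ ^ 2))
      ((hφ.comp (measurable_newtonStep lam S X y)).integral_right (noise d σ₁ σ₂ : Measure _))
      ((hφ.comp (measurable_newtonStep lam S X' y')).integral_right (noise d σ₁ σ₂ : Measure _))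
      fun β => by
        -- Post-processing: for fixed `β`, a test of the new iterate is a test of the noise, and the
        -- shift `δ` may depend on `β`.
        obtain ⟨δ, hδ, hδ₁, hδ₂⟩ := exists_newtonStep_eq_add lam hS hX hy hR hR' β
        have hβ : IsTest fun ξ => φ (newtonStep lam S X y (β, ξ)) :=
          hφ.comp ((measurable_newtonStep lam S X y).comp measurable_prodMk_left)
        have := testBound_noise δ hr₁ hr₂ (hδ₁.trans h₁) (hδ₂.trans h₂) _ hβ
        rw [integral_map (by fun_prop) hβ.measurable.aestronglyMeasurable] at this
        simpa only [hδ] using this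
    rw [Real.sq_sqrt (by positivity), Real.sq_sqrt hc, ← add_one_mul] at h
    exact_mod_cast h

end Neighbours

end PMT

end

/-! ### Calibration of the noise levels -/

theorem theorem5p2 {d n m : ℕ} (T : ℕ) (μ lam η : ℝ) (hμ : 0 < μ) (hη₀ : 0 < η) (hη₁ : η < 1)
    (B : Fin m → Fin d → ℝ) (hB : (PMT.secondMoment B).PosDef) :
    PMT.IsGDP (√2 * μ)
      (PMT.dpPMTLR (n := n) μ lam η T B) := by
  rintro D D' ⟨i, hi⟩ α hα φ hφm hφI hlevel
  have hφ : PMT.IsTest φ := ⟨hφm, hφI⟩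
  have hm := PMT.measurable_mulVec (PMT.invSqrt (PMT.secondMoment B))
  have hS : (PMT.secondMoment B).IsSymm := by
    simpa [IsSymm, IsHermitian, conjTranspose_eq_transpose_of_trivial] using hB.isHermitian
  have hout : ∀ D : Fin n → (Fin d → ℝ) × Fin 2,
      ∫ s, φ s ∂(PMT.dpPMTLR μ lam η T B D : Measure (Fin d → ℝ)) =
      ∫ β, φ (PMT.invSqrt (PMT.secondMoment B) *ᵥ β) ∂(PMT.iterateLaw lam (PMT.secondMoment B)
        (PMT.transform η B fun i => (D i).1) (fun i => (D i).2) (PMT.sigma₁ d n T μ η)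
        (PMT.sigma₂ d n T μ η) T : Measure (Fin d → ℝ)) := fun D =>
    integral_map hm.aemeasurable hφ.measurable.aestronglyMeasurable
  -- The index of the changed sample witnesses that the dataset is nonempty.
  have hn : (0 : ℝ) < n := Nat.cast_pos.2 i.pos
  have hn1 : (1 : ℝ) ≤ n := Nat.one_le_cast.2 i.pos
  have hlog : 0 ≤ Real.log (2 * n / η) :=
    Real.log_nonneg ((one_le_div hη₀).2 (by linarith))
  set R := PMT.radius d n η with hRdef
  have hR0 : 0 ≤ R := Real.sqrt_nonneg _
  have hR2 : R ^ 2 = d * (1 + Real.log (2 * n / η)) := Real.sq_sqrt (by positivity)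
  have hbound : PMT.TestBound (√2 * μ)
      (PMT.iterateLaw lam (PMT.secondMoment B) (PMT.transform η B fun i => (D i).1)
        (fun i => (D i).2) (PMT.sigma₁ d n T μ η) (PMT.sigma₂ d n T μ η) T : Measure (Fin d → ℝ))
      (PMT.iterateLaw lam (PMT.secondMoment B) (PMT.transform η B fun i => (D' i).1)
        (fun i => (D' i).2) (PMT.sigma₁ d n T μ η) (PMT.sigma₂ d n T μ η) T :
        Measure (Fin d → ℝ)) := by
    -- With no iterations the output ignores the data; the split `μ / √T` needs `T > 0`.
    rcases T.eq_zero_or_pos with rfl | hT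
    · exact PMT.TestBound.refl _ (by positivity)
    have hT' : (0 : ℝ) < √T := Real.sqrt_pos.2 (Nat.cast_pos.2 hT)
    have hσ₁ : μ / √T * PMT.sigma₁ d n T μ η = R ^ 2 / (2 * n) := by
      rw [PMT.sigma₁, hR2]
      field_simp
    have hσ₂ : μ / √T * PMT.sigma₂ d n T μ η = 2 * R / n := by
      rw [PMT.sigma₂, mul_assoc (T : ℝ), Real.sqrt_mul (Nat.cast_nonneg T), hRdef, PMT.radius]
      field_simp
    refine (PMT.testBound_iterateLaw lam hS (i := i) (R := R) (r₁ := μ / √T) (r₂ := μ / √T)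
      (fun j hj => by simp only [PMT.transform, hi j hj]) (fun j hj => by rw [hi j hj])
      (PMT.l2norm_transform_le η B _) (PMT.l2norm_transform_le η B _) (by positivity)
      (by positivity) ?_ (by rw [hσ₂]) T).mono (le_of_eq ?_)
    -- The matrix noise is calibrated to `R ^ 4 / (4 n ^ 2)`, twice what the sensitivity requires;
    -- the vector noise is calibrated exactly.
    · rw [hσ₁, div_pow, mul_pow, ← pow_mul]
      gcongr
      norm_num
    · rw [div_pow, Real.sq_sqrt (Nat.cast_nonneg T), show (T : ℝ) * (μ ^ 2 / T + μ ^ 2 / T) =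
        2 * μ ^ 2 by field_simp; ring, Real.sqrt_mul zero_le_two, Real.sqrt_sq hμ.le]
  rw [← PMT.normalPower_eq_one_sub_gaussianTradeoff _ hα]
  rw [hout] at hlevel ⊢
  exact (hbound _ (hφ.comp hm)).trans (PMT.normalPower_mono le_rfl hlevel)
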